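/- Let $\theta>0$, $C>0$, $\mu\in\mathbb R$, $p\in(0,1]$, $n\in\mathbb N$. Let $X_1,\dots,X_n$ be i.i.d. real random variables with mean $\mu$ and $\mathbb P(X_t=0)=0$, such that $X_t-\mu\sim\operatorname{subW}(\theta;C)$, i.e. $\mathbb E\exp(|X_t-\mu|^\theta/C^\theta)\le 2$. Let $Y_1,\dots,Y_n$ be i.i.d. $\operatorname{Bernoulli}(p)$, and let the sequences $(X_t)_t$ and $(Y_t)_t$ be independent of each other. Put $R_t=X_tY_t$, $N=\#\{t\in\{1,\dots,n\}:R_t\ne0\}$ and, when $N>0$, $\overline X^*=\frac1N\sum_{t=1}^nR_t$. Define $$D(\theta)=\begin{cases}(\sqrt2\vee2^{1/\theta})\,\sqrt8\,\mathrm e^3(2\pi)^{1/4}\mathrm e^{1/24}\big(\mathrm e^{2/\mathrm e}/\theta\big)^{1/\theta},&\theta<1,\\ \sqrt{3/(2\mathrm e^2)}\,\big(C^{-1}\vee C^{\theta-1}\big),&1\le\theta<2,\\ \sqrt{17/(6\mathrm e^2)}\,\big(C^{-1}\vee C^{\theta/2-1}\big),&\theta\ge2,\end{cases}\qquad E(\theta)=\begin{cases}2^{2/\theta-1/2},&\theta<1,\\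 1/\sqrt6,&1\le\theta<2,\\ 0,&\theta\ge2,\end{cases}$$ and, for $\delta>0$, $$U_{X^*}=2\mathrm e\,D(\theta)\,C\left(\sqrt{\frac{2\log(4/\delta)}{pn}}+E(\theta)\,\frac{2\,(\log(4/\delta))^{(1/\theta)\vee1}}{pn}\right).$$ Then, for every $\delta>0$ with $n\ge4\log(2/\delta)/p^2$, $$\mathbb P\big\{N=0\ \text{ or }\ |\mu-\overline X^*|\ge U_{X^*}\big\}\le\delta .$$ (For $\delta\geq 1$ the claim is trivial, and $U_{X^*}$ may then be given any value where it is undefined.) In particular, when $\delta<1$, with probability at least $1-\delta$ at least one nonzero reward is observed and $|\mu-\overline X^*|<U_{X^*}$. -/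

import Mathlib

open MeasureTheory ProbabilityTheory

namespace ZeroInflated

noncomputable section

/-- The random variable `Z` is `subW(θ; C)` under `P`: `E exp(|Z|^θ / C^θ)` is finite and at
most `2`. It is used for tail parameter `θ > 0` and size parameter `C > 0` only. -/
structure IsSubWeibull {Ω : Type*} [MeasurableSpace Ω] (P : Measure Ω) (Z : Ω → ℝ) (θ C : ℝ) :
    Prop where
  integrable : Integrable (fun ω => Real.exp (|Z ω| ^ θ / C ^ θ)) P
  integral_le : ∫ ω, Real.exp (|Z ω| ^ θ / C ^ θ) ∂P ≤ 2

/-- The constant `D(θ)`, which for `θ ≥ 1` also depends on the size parameter `C`. -/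
def constD (θ C : ℝ) : ℝ :=
  if θ < 1 then
    max (Real.sqrt 2) ((2 : ℝ) ^ (1 / θ)) * Real.sqrt 8 * Real.exp 3
      * (2 * Real.pi) ^ ((1 : ℝ) / 4) * Real.exp (1 / 24)
      * (Real.exp (2 / Real.exp 1) / θ) ^ (1 / θ)
  else if θ < 2 then
    Real.sqrt (3 / (2 * Real.exp 1 ^ 2)) * max C⁻¹ (C ^ (θ - 1))
  else
    Real.sqrt (17 / (6 * Real.exp 1 ^ 2)) * max C⁻¹ (C ^ (θ / 2 - 1))

/-- The constant `E(θ)`. -/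
def constE (θ : ℝ) : ℝ :=
  if θ < 1 then (2 : ℝ) ^ (2 / θ - 1 / 2)
  else if θ < 2 then 1 / Real.sqrt 6
  else 0

/-- The zero-inflated reward `R = 0 · (1 - Y) + X · Y` at outcomes `x` of `X` and `y` of `Y`. -/
def reward (x y : ℝ) : ℝ := 0 * (1 - y) + x * y

/-- The number of nonzero rewards `#{t ∈ [n] : R_t ≠ 0}`. -/
def numObserved {n : ℕ} (r : Fin n → ℝ) : ℕ := {t : Fin n | r t ≠ 0}.ncard

/-- The mean of the observed nonzero rewards, `(1 / #{t ∈ [n] : R_t ≠ 0}) ∑_t R_t`. -/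
def observedMean {n : ℕ} (r : Fin n → ℝ) : ℝ := 1 / (numObserved r : ℝ) * ∑ t, r t

/-- The deterministic radius `U_{X*}`. -/
def radius (θ C p : ℝ) (n : ℕ) (δ : ℝ) : ℝ :=
  2 * Real.exp 1 * constD θ C * C
    * (Real.sqrt (2 * Real.log (4 / δ) / (p * n))
      + constE θ * (2 * Real.log (4 / δ) ^ max (1 / θ) 1 / (p * n)))

end

end ZeroInflated

namespace ZeroInflated

/-! Almost surely the nonzero rewards are exactly the `X t` with `Y t = 1`. Because the two
sequences are independent, fixing the set S of observed indices does not change the law of the `X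
t`, so the observed mean behaves like an ordinary mean over a deterministic S. Hoeffding's
inequality for the `Y t` gives |S| > pn/2 outside an event of probability δ/4, which turns a
deviation bound in |S| into the stated radius.

For fixed S, `measure_sum_ge_le` bounds each tail of the sum of the normalised variables (X - μ)/C
by (3/2) exp(-L) with L = log(4/δ), that is by 3δ/8. The two tails and the count add up to δ.

The engine is the Chernoff bound `measure_sum_ge_le_of_mgf_le`, for a log-mgf that is at most
quadratic on a range [0, Λ]. For θ ≥ 2 this range is unlimited and no extra term arises. For 1 ≤ θ <
2 it is [0, 1], which costs an additive L. For θ < 1 the mgf may be infinite, so the summands are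
truncated at T with T^θ = 2L + log |S|, high enough that truncation rarely acts and hardly shifts
the mean. -/

theorem exp_mul_le_of_abs_le_one {l : ℝ} (hl : |l| ≤ 1) (x : ℝ) :
    Real.exp (l * x) ≤ 1 + l * x + l ^ 2 * (Real.exp |x| - 1 - |x|) := by
  have h (y : ℝ) : HasSum (fun k : ℕ => y ^ (k + 2) / ((k + 2).factorial : ℝ))
      (Real.exp y - 1 - y) := by
    have h0 : HasSum (fun k : ℕ => y ^ k / (k.factorial : ℝ)) (Real.exp y) := by
      rw [Real.exp_eq_exp_ℝ]; exact NormedSpace.expSeries_div_hasSum_exp y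
    have := (hasSum_nat_add_iff' 2).mpr h0
    convert! this using 1
    simp [Finset.sum_range_succ]; ring
  have := hasSum_le (fun k => ?_) (h (l * x)) ((h |x|).mul_left (l ^ 2))
  · linarith
  · rw [← mul_div_assoc]
    gcongr ?_ / _
    calc (l * x) ^ (k + 2) ≤ |(l * x) ^ (k + 2)| := le_abs_self _
      _ = l ^ 2 * (|l| ^ k * |x| ^ (k + 2)) := by
        rw [abs_pow, abs_mul, mul_pow, pow_add |l|, sq_abs]; ring
      _ ≤ l ^ 2 * (1 * |x| ^ (k + 2)) := by
        gcongr; exact pow_le_one₀ (abs_nonneg _) hl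
      _ = _ := by ring

theorem exp_le_one_add_add_sq_mul_exp_abs (y : ℝ) :
    Real.exp y ≤ 1 + y + y ^ 2 * Real.exp |y| := by
  have h := Complex.norm_exp_sub_sum_le_norm_mul_exp (y : ℂ) 2
  simp only [Finset.sum_range_succ, Finset.sum_range_zero] at h
  norm_num at h
  rw [← Complex.ofReal_exp, ← Complex.ofReal_one, ← Complex.ofReal_add, ← Complex.ofReal_sub,
    Complex.norm_real, Real.norm_eq_abs] at h
  linarith [le_abs_self (Real.exp y - (1 + y))]

/-! ### Chernoff bound with a restricted range -/

variable {Ω : Type*} [MeasurableSpace Ω] {P : Measure Ω} [IsProbabilityMeasure P]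

/-- The unconstrained optimum is l = sqrt(L / (m v)) with m = |S|. If it exceeds Λ, then l = Λ is
used and the slack `r` must pay L / Λ. The disjunction `hΛr` says that one of these always works. -/
theorem measure_sum_ge_le_of_mgf_le {ι : Type*} {Z : ι → Ω → ℝ} (hZ : ∀ i, Measurable (Z i))
    (hind : iIndepFun Z P) (S : Finset ι) {b v Λ L r s : ℝ} (hv : 0 < v) (hΛ : 0 < Λ)
    (hL : 0 ≤ L) (hS : S.Nonempty)
    (hint : ∀ i ∈ S, ∀ l, 0 ≤ l → l ≤ Λ → Integrable (fun ω => Real.exp (l * Z i ω)) P)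
    (hmgf : ∀ i ∈ S, ∀ l, 0 ≤ l → l ≤ Λ → mgf (Z i) P l ≤ Real.exp (l * b + v * l ^ 2))
    (hr : 0 ≤ r) (hΛr : Real.sqrt (L / (S.card * v)) ≤ Λ ∨ L / Λ ≤ r)
    (hs : S.card * b + 2 * Real.sqrt (v * (L * S.card)) + r ≤ s) :
    P.real {ω | s ≤ ∑ i ∈ S, Z i ω} ≤ Real.exp (-L) := by
  have hm : (0 : ℝ) < S.card := by exact_mod_cast hS.card_pos
  set m : ℝ := (S.card : ℝ)
  have key (l : ℝ) (h0 : 0 ≤ l) (h1 : l ≤ Λ) :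
      P.real {ω | s ≤ ∑ i ∈ S, Z i ω} ≤ Real.exp (-l * s + m * (l * b + v * l ^ 2)) := by
    have h := measure_ge_le_exp_mul_mgf (μ := P) (X := ∑ i ∈ S, Z i) s h0
      (hind.integrable_exp_mul_sum hZ fun i hi => hint i hi l h0 h1)
    simp only [Finset.sum_apply] at h
    refine h.trans ?_
    rw [hind.mgf_sum hZ, Real.exp_add]
    gcongr
    calc ∏ i ∈ S, mgf (Z i) P l ≤ ∏ i ∈ S, Real.exp (l * b + v * l ^ 2) :=
          Finset.prod_le_prod (fun i _ => mgf_nonneg) fun i hi => hmgf i hi l h0 h1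
      _ = _ := by rw [Finset.prod_const, ← Real.exp_nat_mul]
  set q := Real.sqrt (v * (L * m))
  have hq : q ^ 2 = v * (L * m) := Real.sq_sqrt (by positivity)
  have hq0 : 0 ≤ q := Real.sqrt_nonneg _
  have ha : Real.sqrt (L / (m * v)) = q / (m * v) := by
    rw [← Real.sqrt_sq (by positivity : 0 ≤ q / (m * v))]
    congr 1
    rw [div_pow, hq]; field_simp
  by_cases hc : q / (m * v) ≤ Λ
  · refine (key _ (by positivity) hc).trans (Real.exp_le_exp.mpr ?_)
    have h1 : q / (m * v) * (m * b + 2 * q + r) ≤ q / (m * v) * s := by gcongr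
    have h2 : q / (m * v) * q = L := by rw [div_mul_eq_mul_div, ← sq, hq]; field_simp
    have h3 : m * (v * (q / (m * v)) ^ 2) = L := by rw [← h2]; field_simp
    have h4 : 0 ≤ q / (m * v) * r := by positivity
    nlinarith
  · push Not at hc
    have hr' : L / Λ ≤ r := by
      rcases hΛr with h | h
      · rw [ha] at h; linarith
      · exact h
    refine (key Λ hΛ.le le_rfl).trans (Real.exp_le_exp.mpr ?_)
    have h1 : Λ * (m * b + 2 * q + r) ≤ Λ * s := by gcongr
    rw [div_le_iff₀ hΛ] at hr'
    -- Here Λ m v < q, so the quadratic term m v Λ² is absorbed by one of the two copies of Λ q.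
    rw [lt_div_iff₀ (by positivity)] at hc
    have h2 : Λ * (Λ * (m * v)) ≤ Λ * q := by gcongr
    have h3 : 0 ≤ Λ * q := by positivity
    nlinarith

/-! ### Light tails: θ ≥ 1 -/

section Light

variable {W : Ω → ℝ} {θ : ℝ}

theorem self_le_rpow_of_one_le (hθ : 1 ≤ θ) {u : ℝ} (hu : 1 ≤ u) : u ≤ u ^ θ := by
  simpa using Real.rpow_le_rpow_of_exponent_le hu hθ

theorem exp_sub_one_sub_le_add_one (hθ : 1 ≤ θ) {u : ℝ} (hu : 0 ≤ u) :
    Real.exp u - 1 - u ≤ Real.exp (u ^ θ) := by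
  rcases le_total 1 u with h | h
  · have := Real.exp_le_exp.mpr (self_le_rpow_of_one_le hθ h)
    linarith
  · have h1 := Real.abs_exp_sub_one_sub_id_le (x := u) (by rwa [abs_of_nonneg hu])
    have h2 := le_abs_self (Real.exp u - 1 - u)
    have h3 := Real.one_le_exp (Real.rpow_nonneg hu θ)
    nlinarith

theorem exp_sub_one_sub_le (hθ : 1 ≤ θ) (hθ2 : θ ≤ 2) {u : ℝ} (hu : 0 ≤ u) :
    Real.exp u - 1 - u ≤ Real.exp (u ^ θ) - 1 := by
  rcases le_total 1 u with h | h
  · have := Real.exp_le_exp.mpr (self_le_rpow_of_one_le hθ h)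
    linarith
  · have h1 := Real.abs_exp_sub_one_sub_id_le (x := u) (by rwa [abs_of_nonneg hu])
    have h2 := le_abs_self (Real.exp u - 1 - u)
    have h3 := Real.add_one_le_exp (u ^ θ)
    have h4 : u ^ 2 ≤ u ^ θ := by
      rcases hu.eq_or_lt with rfl | hu
      · simpa using Real.rpow_nonneg le_rfl θ
      · simpa using Real.rpow_le_rpow_of_exponent_ge hu h hθ2
    linarith

omit [IsProbabilityMeasure P] in
theorem integrable_of_le_exp (hWm : Measurable W)
    (hint : Integrable (fun ω => Real.exp (|W ω| ^ θ)) P) {f : ℝ → ℝ} (hf : Measurable f) (A : ℝ)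
    (hle : ∀ x, |f x| ≤ A * Real.exp (|x| ^ θ)) : Integrable (fun ω => f (W ω)) P :=
  (hint.const_mul A).mono' (hf.comp hWm).aestronglyMeasurable
    (Filter.Eventually.of_forall fun ω => hle (W ω))

/-- For 0 ≤ l ≤ 1 the Taylor remainder of exp (l x) is at most l² times that of exp |x|, which
`hquad` dominates by the sub-Weibull integrand. Centring removes the linear term. -/
theorem mgf_le_of_quadratic (hWm : Measurable W)
    (hint : Integrable (fun ω => Real.exp (|W ω| ^ θ)) P)
    (hle : ∫ ω, Real.exp (|W ω| ^ θ) ∂P ≤ 2) (hWint : Integrable W P) (hW0 : ∫ ω, W ω ∂P = 0)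
    {v c : ℝ} (hvc : 2 - c ≤ v)
    (hquad : ∀ u, 0 ≤ u → Real.exp u - 1 - u ≤ Real.exp (u ^ θ) - c)
    {l : ℝ} (hl0 : 0 ≤ l) (hl1 : l ≤ 1) :
    Integrable (fun ω => Real.exp (l * W ω)) P ∧ mgf W P l ≤ Real.exp (v * l ^ 2) := by
  have hpt (x : ℝ) : Real.exp (l * x) ≤ 1 + l * x + l ^ 2 * (Real.exp (|x| ^ θ) - c) := by
    refine (exp_mul_le_of_abs_le_one (by rwa [abs_of_nonneg hl0]) x).trans ?_
    have := mul_le_mul_of_nonneg_left (hquad _ (abs_nonneg x)) (sq_nonneg l)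
    linarith
  have hI1 : Integrable (fun ω => 1 + l * W ω) P := (integrable_const 1).add (hWint.const_mul l)
  have hI2 : Integrable (fun ω => l ^ 2 * (Real.exp (|W ω| ^ θ) - c)) P :=
    (hint.sub (integrable_const c)).const_mul _
  have hI := hI1.add hI2
  have hE : Integrable (fun ω => Real.exp (l * W ω)) P :=
    hI.mono' (by fun_prop) (Filter.Eventually.of_forall fun ω => by
      rw [Real.norm_eq_abs, Real.abs_exp]; exact hpt _)
  refine ⟨hE, ?_⟩
  calc mgf W P l ≤ ∫ ω, 1 + l * W ω + l ^ 2 * (Real.exp (|W ω| ^ θ) - c) ∂P :=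
        integral_mono hE hI fun ω => hpt _
    _ = 1 + l ^ 2 * ((∫ ω, Real.exp (|W ω| ^ θ) ∂P) - c) := by
      rw [integral_add hI1 hI2, integral_add (integrable_const 1) (hWint.const_mul l),
        integral_const_mul, integral_const_mul, integral_sub hint (integrable_const c), hW0]
      simp
    _ ≤ 1 + l ^ 2 * v := by gcongr; linarith
    _ ≤ Real.exp (v * l ^ 2) := by linarith [Real.add_one_le_exp (v * l ^ 2)]

theorem mgf_le_of_two_le (hθ : 2 ≤ θ) (hWm : Measurable W)
    (hint : Integrable (fun ω => Real.exp (|W ω| ^ θ)) P)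
    (hle : ∫ ω, Real.exp (|W ω| ^ θ) ∂P ≤ 2) (hWint : Integrable W P) (hW0 : ∫ ω, W ω ∂P = 0)
    {l : ℝ} (hl0 : 0 ≤ l) :
    Integrable (fun ω => Real.exp (l * W ω)) P ∧ mgf W P l ≤ Real.exp (2 * l ^ 2) := by
  rcases le_total l 1 with hl1 | hl1
  · exact mgf_le_of_quadratic hWm hint hle hWint hW0 (c := 0) (by norm_num)
      (fun u hu => by simpa using exp_sub_one_sub_le_add_one (by linarith) hu) hl0 hl1
  -- For l ≥ 1, Young's inequality gives l x ≤ l²/4 + x². The factor 2 from the moment bound is at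
  -- most exp (3/4), and l²/4 + 1 + 3/4 ≤ 2 l².
  · have hpt (x : ℝ) : Real.exp (l * x) ≤ Real.exp (l ^ 2 / 4 + 1) * Real.exp (|x| ^ θ) := by
      rw [← Real.exp_add, Real.exp_le_exp]
      have h1 : l * x ≤ l ^ 2 / 4 + |x| ^ 2 := by
        rw [sq_abs]; nlinarith [sq_nonneg (l / 2 - x)]
      have h2 : |x| ^ 2 ≤ 1 + |x| ^ θ := by
        have h0 := Real.rpow_nonneg (abs_nonneg x) θ
        rcases le_total |x| 1 with h | h
        · nlinarith [abs_nonneg x]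
        · have := Real.rpow_le_rpow_of_exponent_le h hθ
          rw [Real.rpow_two] at this
          linarith
      linarith
    have hI := hint.const_mul (Real.exp (l ^ 2 / 4 + 1))
    have hE : Integrable (fun ω => Real.exp (l * W ω)) P :=
      hI.mono' (by fun_prop) (Filter.Eventually.of_forall fun ω => by
        rw [Real.norm_eq_abs, Real.abs_exp]; exact hpt _)
    refine ⟨hE, ?_⟩
    calc mgf W P l ≤ ∫ ω, Real.exp (l ^ 2 / 4 + 1) * Real.exp (|W ω| ^ θ) ∂P :=
          integral_mono hE hI fun ω => hpt _
      _ ≤ Real.exp (l ^ 2 / 4 + 1) * 2 := by rw [integral_const_mul]; gcongr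
      _ ≤ Real.exp (l ^ 2 / 4 + 1) * Real.exp (3 / 4) := by
        gcongr
        have := Real.quadratic_le_exp_of_nonneg (x := 3 / 4) (by norm_num)
        linarith
      _ ≤ Real.exp (2 * l ^ 2) := by
        rw [← Real.exp_add, Real.exp_le_exp]; nlinarith

end Light

/-! ### Heavy tails: truncation -/

/-- The constant `(4 / (e θ))^{1/θ}` in `x ≤ constB θ * exp (x ^ θ / 4)`. -/
noncomputable def constB (θ : ℝ) : ℝ := (4 / (Real.exp 1 * θ)) ^ (1 / θ)

theorem constB_pos {θ : ℝ} (hθ : 0 < θ) : 0 < constB θ := by unfold constB; positivity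

/-- This is y ≤ exp (y - 1) at y = θ x^θ / 4, raised to the power 1/θ. The quarter in the exponent
is chosen so that x² costs only half of x^θ, leaving the other half for exp |l x|. -/
theorem le_constB_mul_exp {θ : ℝ} (hθ : 0 < θ) {x : ℝ} (hx : 0 ≤ x) :
    x ≤ constB θ * Real.exp (x ^ θ / 4) := by
  have h : x ^ θ ≤ 4 / (Real.exp 1 * θ) * Real.exp (θ * x ^ θ / 4) := by
    have := Real.add_one_le_exp (θ * x ^ θ / 4 - 1)
    rw [Real.exp_sub] at this
    have h2 := mul_le_mul_of_nonneg_left this (by positivity : 0 ≤ 4 / θ)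
    calc x ^ θ = 4 / θ * (θ * x ^ θ / 4 - 1 + 1) := by field_simp; ring
      _ ≤ _ := h2
      _ = _ := by field_simp
  have h2 := Real.rpow_le_rpow (by positivity) h (by positivity : 0 ≤ 1 / θ)
  rw [← Real.rpow_mul hx, mul_one_div_cancel hθ.ne', Real.rpow_one,
    Real.mul_rpow (by positivity) (by positivity), ← Real.exp_mul] at h2
  refine h2.trans_eq ?_
  rw [constB]
  congr 2
  field_simp

theorem le_constB_mul_exp_half {θ : ℝ} (hθ : 0 < θ) {x : ℝ} (hx : 0 ≤ x) :
    x ≤ constB θ * Real.exp (x ^ θ / 2) := by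
  refine (le_constB_mul_exp hθ hx).trans ?_
  have := constB_pos hθ
  gcongr
  norm_num

theorem sq_le_constB_mul_exp_half {θ : ℝ} (hθ : 0 < θ) {x : ℝ} (hx : 0 ≤ x) :
    x ^ 2 ≤ constB θ ^ 2 * Real.exp (x ^ θ / 2) := by
  refine (pow_le_pow_left₀ hx (le_constB_mul_exp hθ hx) 2).trans_eq ?_
  rw [mul_pow, ← Real.exp_nat_mul]
  congr 2
  push_cast; ring

/-- `x` truncated to `0` where `|x|` exceeds `T`. -/
noncomputable def truncate (T x : ℝ) : ℝ := if |x| ≤ T then x else 0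

theorem measurable_truncate (T : ℝ) : Measurable (truncate T) :=
  Measurable.ite (measurableSet_le (by fun_prop) measurable_const) measurable_id measurable_const

/-- Where |x| ≤ T, the condition on l and θ ≤ 1 give |l x| ≤ |x|^θ / 2, so the second-order
remainder is controlled. Where |x| > T the left side is 1 and l x must be compensated; this bias
carries the small factor exp (-T^θ / 2). -/
theorem exp_mul_truncate_le {θ : ℝ} (hθ0 : 0 < θ) (hθ1 : θ ≤ 1) {T l : ℝ} (hT : 0 < T)
    (hl0 : 0 ≤ l) (hl : l ≤ T ^ (θ - 1) / 2) (x : ℝ) :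
    Real.exp (l * truncate T x) ≤ 1 + l * x +
      (l * (constB θ * Real.exp (-(T ^ θ / 2))) + l ^ 2 * constB θ ^ 2) *
        Real.exp (|x| ^ θ) := by
  have hB := constB_pos hθ0
  unfold truncate
  split_ifs with h
  · have h1 := exp_le_one_add_add_sq_mul_exp_abs (l * x)
    have h2 : |l * x| ≤ |x| ^ θ / 2 := by
      rw [abs_mul, abs_of_nonneg hl0]
      rcases (abs_nonneg x).eq_or_lt with h0 | h0
      · rw [← h0]; simp; positivity
      have h3 : T ^ (θ - 1) ≤ |x| ^ (θ - 1) :=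
        Real.rpow_le_rpow_of_nonpos h0 h (by linarith)
      calc l * |x| ≤ |x| ^ (θ - 1) / 2 * |x| := by gcongr; linarith
        _ = |x| ^ θ / 2 := by rw [Real.rpow_sub_one h0.ne']; field_simp
    have h3 : (l * x) ^ 2 * Real.exp |l * x| ≤ l ^ 2 * constB θ ^ 2 * Real.exp (|x| ^ θ) := by
      calc (l * x) ^ 2 * Real.exp |l * x| = l ^ 2 * |x| ^ 2 * Real.exp |l * x| := by
            rw [sq_abs]; ring
        _ ≤ l ^ 2 * (constB θ ^ 2 * Real.exp (|x| ^ θ / 2)) * Real.exp (|x| ^ θ / 2) := by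
            gcongr; exact sq_le_constB_mul_exp_half hθ0 (abs_nonneg x)
        _ = l ^ 2 * constB θ ^ 2 * Real.exp (|x| ^ θ / 2 + |x| ^ θ / 2) := by
            rw [Real.exp_add]; ring
        _ = _ := by rw [add_halves]
    have h4 : 0 ≤ l * (constB θ * Real.exp (-(T ^ θ / 2))) * Real.exp (|x| ^ θ) := by positivity
    linarith
  · push Not at h
    have h1 : |x| ≤ constB θ * Real.exp (-(T ^ θ / 2)) * Real.exp (|x| ^ θ) := by
      refine (le_constB_mul_exp_half hθ0 (abs_nonneg x)).trans ?_
      rw [mul_assoc, ← Real.exp_add]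
      have : T ^ θ ≤ |x| ^ θ := by gcongr
      gcongr
      linarith
    have h2 := mul_le_mul_of_nonneg_left h1 hl0
    have h3 := mul_le_mul_of_nonneg_left (neg_abs_le x) hl0
    have h4 : 0 ≤ l ^ 2 * constB θ ^ 2 * Real.exp (|x| ^ θ) := by positivity
    rw [mul_zero, Real.exp_zero]
    linarith

theorem mgf_truncate_le {θ : ℝ} (hθ0 : 0 < θ) (hθ1 : θ ≤ 1) {W : Ω → ℝ} (hWm : Measurable W)
    (hint : Integrable (fun ω => Real.exp (|W ω| ^ θ)) P)
    (hle : ∫ ω, Real.exp (|W ω| ^ θ) ∂P ≤ 2) (hWint : Integrable W P) (hW0 : ∫ ω, W ω ∂P = 0)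
    {T l : ℝ} (hT : 0 < T) (hl0 : 0 ≤ l) (hl : l ≤ T ^ (θ - 1) / 2) :
    Integrable (fun ω => Real.exp (l * truncate T (W ω))) P ∧
      mgf (fun ω => truncate T (W ω)) P l ≤
        Real.exp (l * (2 * (constB θ * Real.exp (-(T ^ θ / 2)))) +
          (2 * constB θ ^ 2) * l ^ 2) := by
  have hpt := exp_mul_truncate_le hθ0 hθ1 hT hl0 hl
  have hB := constB_pos hθ0
  set κ := l * (constB θ * Real.exp (-(T ^ θ / 2))) + l ^ 2 * constB θ ^ 2 with hκ
  have hκ0 : 0 ≤ κ := by positivity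
  have hI1 : Integrable (fun ω => 1 + l * W ω) P := (integrable_const 1).add (hWint.const_mul l)
  have hI2 : Integrable (fun ω => κ * Real.exp (|W ω| ^ θ)) P := hint.const_mul _
  have hI := hI1.add hI2
  have hm : Measurable fun ω => Real.exp (l * truncate T (W ω)) :=
    (((measurable_truncate T).comp hWm).const_mul l).exp
  have hE : Integrable (fun ω => Real.exp (l * truncate T (W ω))) P :=
    hI.mono' hm.aestronglyMeasurable (Filter.Eventually.of_forall fun ω => by
      rw [Real.norm_eq_abs, Real.abs_exp]; exact hpt _)
  refine ⟨hE, ?_⟩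
  calc mgf (fun ω => truncate T (W ω)) P l
      ≤ ∫ ω, 1 + l * W ω + κ * Real.exp (|W ω| ^ θ) ∂P := integral_mono hE hI fun ω => hpt _
    _ = 1 + κ * ∫ ω, Real.exp (|W ω| ^ θ) ∂P := by
      rw [integral_add hI1 hI2, integral_add (integrable_const 1) (hWint.const_mul l),
        integral_const_mul, integral_const_mul, hW0]
      simp
    _ ≤ 1 + κ * 2 := by gcongr
    _ ≤ Real.exp (κ * 2) := by linarith [Real.add_one_le_exp (κ * 2)]
    _ = _ := by rw [hκ]; ring_nf

theorem measure_lt_abs_le {θ : ℝ} (hθ0 : 0 < θ) {W : Ω → ℝ}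
    (hint : Integrable (fun ω => Real.exp (|W ω| ^ θ)) P)
    (hle : ∫ ω, Real.exp (|W ω| ^ θ) ∂P ≤ 2) {T : ℝ} (hT : 0 ≤ T) :
    P.real {ω | T < |W ω|} ≤ 2 * Real.exp (-T ^ θ) := by
  have h := mul_meas_ge_le_integral_of_nonneg (μ := P)
    (Filter.Eventually.of_forall fun ω => (Real.exp_pos (|W ω| ^ θ)).le) hint (Real.exp (T ^ θ))
  have h1 : P.real {ω | T < |W ω|} ≤ P.real {ω | Real.exp (T ^ θ) ≤ Real.exp (|W ω| ^ θ)} := by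
    refine measureReal_mono fun ω hω => ?_
    simp only [Set.mem_ofPred_eq] at hω ⊢
    gcongr
  have h2 := (mul_le_mul_of_nonneg_left h1 (Real.exp_pos (T ^ θ)).le).trans (h.trans hle)
  rw [Real.exp_neg, ← div_eq_mul_inv, le_div_iff₀ (Real.exp_pos _)]
  linarith

theorem measure_sum_ge_le_of_lt_one {θ : ℝ} (hθ0 : 0 < θ) (hθ1 : θ ≤ 1) {ι : Type*}
    {W : ι → Ω → ℝ} (hWm : ∀ i, Measurable (W i)) (hind : iIndepFun W P)
    (hint : ∀ i, Integrable (fun ω => Real.exp (|W i ω| ^ θ)) P)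
    (hle : ∀ i, ∫ ω, Real.exp (|W i ω| ^ θ) ∂P ≤ 2) (hWint : ∀ i, Integrable (W i) P)
    (hW0 : ∀ i, ∫ ω, W i ω ∂P = 0) {S : Finset ι} (hS : S.Nonempty) {L s : ℝ} (hL1 : 1 ≤ L)
    (hL : Real.exp (-L) ≤ 1 / 4)
    (hs : 5 * constB θ * Real.sqrt (L * S.card) + (4 : ℝ) ^ (1 / θ) * L ^ (1 / θ) ≤ s) :
    P.real {ω | s ≤ ∑ i ∈ S, W i ω} ≤ 3 / 2 * Real.exp (-L) := by
  have hB := constB_pos hθ0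
  have hm1 : (1 : ℝ) ≤ S.card := by exact_mod_cast hS.card_pos
  have hlog := Real.log_nonneg hm1
  -- The term log |S| pays for the union bound over S; 2 L leaves exp (-2L) there and exp (-L) in
  -- the bias.
  set A : ℝ := 2 * L + Real.log S.card with hA
  set T : ℝ := A ^ (1 / θ) with hTdef
  have hA0 : 0 < A := by positivity
  have hT : 0 < T := by positivity
  have hTA : T ^ θ = A := by
    rw [hTdef, ← Real.rpow_mul hA0.le, one_div_mul_cancel hθ0.ne', Real.rpow_one]
  have hexpA : S.card * Real.exp (-A) = Real.exp (-L) * Real.exp (-L) := by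
    rw [hA, ← Real.exp_add, neg_add, Real.exp_add (-(2 * L)), Real.exp_neg (Real.log _),
      Real.exp_log (by linarith), mul_comm (Real.exp _), mul_inv_cancel_left₀ (by linarith)]
    ring_nf
  have hexpA2 : S.card * Real.exp (-(A / 2)) = Real.exp (-L) * Real.sqrt S.card := by
    refine (pow_left_inj₀ (by positivity) (by positivity) two_ne_zero).mp ?_
    rw [mul_pow, mul_pow, ← Real.exp_nat_mul, Real.sq_sqrt (by linarith), sq (Real.exp _), ← hexpA]
    push_cast
    ring_nf
  have htail : P.real {ω | ∃ i ∈ S, T < |W i ω|} ≤ 1 / 2 * Real.exp (-L) := by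
    have hU : {ω | ∃ i ∈ S, T < |W i ω|} = ⋃ i ∈ S, {ω | T < |W i ω|} := by ext; simp
    rw [hU]
    calc P.real (⋃ i ∈ S, {ω | T < |W i ω|}) ≤ ∑ i ∈ S, P.real {ω | T < |W i ω|} :=
          measureReal_biUnion_finset_le _ _
      _ ≤ ∑ i ∈ S, 2 * Real.exp (-A) :=
          Finset.sum_le_sum fun i _ => hTA ▸ measure_lt_abs_le hθ0 (hint i) (hle i) hT.le
      _ = 2 * (S.card * Real.exp (-A)) := by rw [Finset.sum_const, nsmul_eq_mul]; ring
      _ ≤ _ := by rw [hexpA]; nlinarith [Real.exp_pos (-L)]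
  have hΛ : 0 < T ^ (θ - 1) / 2 := by positivity
  have hLΛ : L / (T ^ (θ - 1) / 2) ≤ T := by
    rw [div_le_iff₀ hΛ, Real.rpow_sub_one hT.ne', hTA]
    field_simp
    linarith
  -- If log |S| ≤ 2L then A ≤ 4L; otherwise A ≤ 2 log |S|, and a power of a logarithm is at most a
  -- multiple of sqrt |S|.
  have hTle : T ≤ constB θ * Real.sqrt S.card + (4 : ℝ) ^ (1 / θ) * L ^ (1 / θ) := by
    rcases le_total (Real.log S.card) (2 * L) with h | h
    · have : T ≤ (4 : ℝ) ^ (1 / θ) * L ^ (1 / θ) := by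
        rw [← Real.mul_rpow (by norm_num) (by linarith)]
        exact Real.rpow_le_rpow hA0.le (by linarith) (by positivity)
      have : 0 ≤ constB θ * Real.sqrt S.card := by positivity
      linarith
    · have h1 : T ≤ (2 * Real.log S.card) ^ (1 / θ) :=
        Real.rpow_le_rpow hA0.le (by linarith) (by positivity)
      have h2 := le_constB_mul_exp hθ0 (x := (2 * Real.log S.card) ^ (1 / θ)) (by positivity)
      rw [← Real.rpow_mul (by positivity), one_div_mul_cancel hθ0.ne', Real.rpow_one] at h2
      have h3 : Real.exp (2 * Real.log S.card / 4) = Real.sqrt S.card := by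
        rw [Real.sqrt_eq_rpow, Real.rpow_def_of_pos (by linarith)]
        ring_nf
      rw [h3] at h2
      have : 0 ≤ (4 : ℝ) ^ (1 / θ) * L ^ (1 / θ) := by positivity
      linarith
  have hind' : iIndepFun (fun i ω => truncate T (W i ω)) P :=
    hind.comp (fun _ => truncate T) fun _ => measurable_truncate T
  have hq1 : Real.sqrt S.card ≤ Real.sqrt (L * S.card) :=
    Real.sqrt_le_sqrt (by nlinarith)
  have hq2 : Real.sqrt (2 * constB θ ^ 2 * (L * S.card)) ≤
      3 / 2 * (constB θ * Real.sqrt (L * S.card)) := by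
    rw [Real.sqrt_le_left (by positivity), mul_pow, mul_pow, Real.sq_sqrt (by positivity)]
    have : 0 ≤ constB θ ^ 2 * (L * S.card) := by positivity
    linarith
  have hmain : P.real {ω | s ≤ ∑ i ∈ S, truncate T (W i ω)} ≤ Real.exp (-L) := by
    refine measure_sum_ge_le_of_mgf_le (fun i => (measurable_truncate T).comp (hWm i)) hind' S
      (b := 2 * (constB θ * Real.exp (-(T ^ θ / 2)))) (v := 2 * constB θ ^ 2) (r := T)
      (by positivity) hΛ (by linarith) hS
      (fun i _ l h0 h1 => (mgf_truncate_le hθ0 hθ1 (hWm i) (hint i) (hle i) (hWint i) (hW0 i)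
        hT h0 h1).1)
      (fun i _ l h0 h1 => (mgf_truncate_le hθ0 hθ1 (hWm i) (hint i) (hle i) (hWint i) (hW0 i)
        hT h0 h1).2) hT.le (Or.inr hLΛ) (le_trans ?_ hs)
    -- Multiples of B sqrt(L |S|), with B = `constB θ`: 1/2 from the bias, 3 from the Chernoff term
    -- and 1 from T, within the 5 allowed.
    have hb : S.card * (2 * (constB θ * Real.exp (-(T ^ θ / 2)))) ≤
        1 / 2 * (constB θ * Real.sqrt (L * S.card)) := by
      calc S.card * (2 * (constB θ * Real.exp (-(T ^ θ / 2))))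
          = 2 * constB θ * (S.card * Real.exp (-(A / 2))) := by rw [hTA]; ring
        _ = 2 * constB θ * (Real.exp (-L) * Real.sqrt S.card) := by rw [hexpA2]
        _ ≤ 2 * constB θ * (1 / 4 * Real.sqrt (L * S.card)) := by gcongr
        _ = _ := by ring
    have h5 := mul_le_mul_of_nonneg_left hq1 hB.le
    have h6 : 0 ≤ constB θ * Real.sqrt (L * S.card) := by positivity
    linarith
  have hsub : {ω | s ≤ ∑ i ∈ S, W i ω} ⊆
      {ω | ∃ i ∈ S, T < |W i ω|} ∪ {ω | s ≤ ∑ i ∈ S, truncate T (W i ω)} := by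
    intro ω hω
    by_cases h : ∃ i ∈ S, T < |W i ω|
    · exact Or.inl h
    · push Not at h
      right
      have : ∑ i ∈ S, truncate T (W i ω) = ∑ i ∈ S, W i ω :=
        Finset.sum_congr rfl fun i hi => if_pos (h i hi)
      simpa [this] using hω
  calc _ ≤ _ := measureReal_mono hsub
    _ ≤ _ := measureReal_union_le _ _
    _ ≤ _ := by linarith

/-! ### Comparison with the constants D and E -/

theorem two_mul_exp_mul_sqrt_div (a b : ℝ) :
    2 * Real.exp 1 * Real.sqrt (a / (b * Real.exp 1 ^ 2)) = 2 * Real.sqrt (a / b) := by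
  have he := Real.exp_pos 1
  have : a / (b * Real.exp 1 ^ 2) = a / b / Real.exp 1 ^ 2 := by rw [div_div]
  rw [this, Real.sqrt_div' _ (by positivity), Real.sqrt_sq he.le]
  field_simp

theorem constD_lower {θ : ℝ} (hθ0 : 0 < θ) (hθ1 : θ < 1) (C : ℝ) :
    32 * (Real.exp (2 / Real.exp 1) / θ) ^ (1 / θ) ≤ 2 * Real.exp 1 * constD θ C := by
  rw [constD, if_pos hθ1]
  set g := (Real.exp (2 / Real.exp 1) / θ) ^ (1 / θ)
  have hg : 0 ≤ g := by positivity
  have e1 : (2 : ℝ) ≤ Real.exp 1 := by linarith [Real.add_one_le_exp (1 : ℝ)]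
  have e3 : (8 : ℝ) ≤ Real.exp 3 := by
    have : Real.exp 3 = Real.exp 1 ^ 3 := by rw [← Real.exp_nat_mul]; norm_num
    rw [this]
    calc (8 : ℝ) = 2 ^ 3 := by norm_num
      _ ≤ _ := by gcongr
  have h1 : (1 : ℝ) ≤ max (Real.sqrt 2) ((2 : ℝ) ^ (1 / θ)) :=
    le_max_of_le_right (Real.one_le_rpow (by norm_num) (by positivity))
  have h2 : (1 : ℝ) ≤ Real.sqrt 8 := Real.one_le_sqrt.mpr (by norm_num)
  have h3 : (1 : ℝ) ≤ (2 * Real.pi) ^ ((1 : ℝ) / 4) :=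
    Real.one_le_rpow (by linarith [Real.pi_gt_three]) (by norm_num)
  have h4 : (1 : ℝ) ≤ Real.exp (1 / 24) := Real.one_le_exp (by norm_num)
  calc 32 * g = 2 * 2 * (1 * 1 * 8 * 1 * 1 * g) := by ring
    _ ≤ _ := by gcongr

/-- After cancelling, this is 4/e ≤ 1 + 2/e ≤ exp (2/e), using e ≥ 2. -/
theorem constB_le {θ : ℝ} (hθ0 : 0 < θ) :
    constB θ ≤ (Real.exp (2 / Real.exp 1) / θ) ^ (1 / θ) := by
  unfold constB
  rw [← div_div]
  gcongr
  have e1 : (2 : ℝ) ≤ Real.exp 1 := by linarith [Real.add_one_le_exp (1 : ℝ)]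
  refine le_trans ?_ (Real.add_one_le_exp _)
  rw [div_add_one (by positivity)]
  gcongr
  linarith

theorem measure_sum_ge_le {θ : ℝ} (hθ : 0 < θ) {ι : Type*}
    {W : ι → Ω → ℝ} (hWm : ∀ i, Measurable (W i)) (hind : iIndepFun W P)
    (hint : ∀ i, Integrable (fun ω => Real.exp (|W i ω| ^ θ)) P)
    (hle : ∀ i, ∫ ω, Real.exp (|W i ω| ^ θ) ∂P ≤ 2) (hWint : ∀ i, Integrable (W i) P)
    (hW0 : ∀ i, ∫ ω, W i ω ∂P = 0) {S : Finset ι} (hS : S.Nonempty) {L s : ℝ} (hL1 : 1 ≤ L)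
    (hL : Real.exp (-L) ≤ 1 / 4)
    (hs : 2 * Real.exp 1 * constD θ 1 *
      (Real.sqrt (L * S.card) + constE θ * L ^ max (1 / θ) 1) ≤ s) :
    P.real {ω | s ≤ ∑ i ∈ S, W i ω} ≤ 3 / 2 * Real.exp (-L) := by
  rcases lt_or_ge θ 1 with hθ1 | hθ1
  · refine measure_sum_ge_le_of_lt_one hθ hθ1.le hWm hind hint hle hWint hW0 hS hL1 hL
      (le_trans ?_ hs)
    have h1 := constD_lower hθ hθ1 1
    have hmax : max (1 / θ) 1 = 1 / θ := max_eq_left ((one_le_div hθ).mpr hθ1.le)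
    rw [hmax, constE, if_pos hθ1]
    set K := 2 * Real.exp 1 * constD θ 1
    have h2 : 5 * constB θ ≤ K := by linarith [constB_le hθ, constB_pos hθ]
    have h3 : 32 ≤ K := by
      have : 1 ≤ (Real.exp (2 / Real.exp 1) / θ) ^ (1 / θ) := by
        refine Real.one_le_rpow ((one_le_div hθ).mpr (hθ1.le.trans ?_)) (by positivity)
        exact Real.one_le_exp (by positivity)
      linarith
    have h4 : (4 : ℝ) ^ (1 / θ) ≤ 2 * (2 : ℝ) ^ (2 / θ - 1 / 2) := by
      have : (4 : ℝ) = 2 ^ (2 : ℝ) := by norm_num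
      rw [this, ← Real.rpow_mul (by norm_num)]
      calc (2 : ℝ) ^ (2 * (1 / θ)) ≤ (2 : ℝ) ^ (1 + (2 / θ - 1 / 2)) := by
            apply Real.rpow_le_rpow_of_exponent_le (by norm_num)
            have : 2 * (1 / θ) = 2 / θ := by ring
            linarith
        _ = _ := by rw [Real.rpow_add (by norm_num), Real.rpow_one]
    have h5 : (4 : ℝ) ^ (1 / θ) ≤ K * (2 : ℝ) ^ (2 / θ - 1 / 2) := by
      refine h4.trans ?_
      gcongr
      linarith
    rw [mul_add, ← mul_assoc]
    gcongr
  · have hmax : max (1 / θ) 1 = 1 := max_eq_right ((div_le_one hθ).mpr hθ1)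
    rw [hmax, Real.rpow_one, constD, constE, if_neg hθ1.not_gt, if_neg hθ1.not_gt] at hs
    have hm0 : (0 : ℝ) < S.card := by exact_mod_cast hS.card_pos
    have hq : 0 ≤ Real.sqrt (L * S.card) := Real.sqrt_nonneg _
    suffices P.real {ω | s ≤ ∑ i ∈ S, W i ω} ≤ Real.exp (-L) by
      linarith [Real.exp_pos (-L)]
    rcases lt_or_ge θ 2 with hθ2 | hθ2
    · rw [if_pos hθ2, if_pos hθ2, inv_one, Real.one_rpow, max_self, mul_one,
        two_mul_exp_mul_sqrt_div] at hs
      have hmgf (i : ι) (l : ℝ) (h0 : 0 ≤ l) (h1 : l ≤ 1) :=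
        mgf_le_of_quadratic (hWm i) (hint i) (hle i) (hWint i) (hW0 i) (v := 1) (c := 1)
          (by norm_num) (fun u hu => exp_sub_one_sub_le hθ1 hθ2.le hu) h0 h1
      refine measure_sum_ge_le_of_mgf_le hWm hind S (b := 0) (v := 1) (r := L) (Λ := 1) one_pos
        one_pos (by linarith) hS (fun i _ l h0 h1 => (hmgf i l h0 h1).1)
        (fun i _ l h0 h1 => by simpa using (hmgf i l h0 h1).2) (by linarith)
        (Or.inr (by simp)) (le_trans ?_ hs)
      -- Here 2 e D = sqrt 6 and E = 1 / sqrt 6, so the linear term is exactly L.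
      have h6 : Real.sqrt 6 = 2 * Real.sqrt (3 / 2) := by
        rw [show (6 : ℝ) = 2 ^ 2 * (3 / 2) by norm_num, Real.sqrt_mul (by norm_num),
          Real.sqrt_sq (by norm_num)]
      have h7 : (0 : ℝ) < Real.sqrt 6 := by positivity
      rw [← h6, mul_add, ← mul_assoc (Real.sqrt 6), mul_one_div_cancel h7.ne', h6]
      have h8 : 1 ≤ Real.sqrt (3 / 2) := Real.one_le_sqrt.mpr (by norm_num)
      simp only [mul_zero, zero_add, one_mul]
      gcongr
      linarith
    · rw [if_neg hθ2.not_gt, if_neg hθ2.not_gt, inv_one, Real.one_rpow, max_self, mul_one,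
        two_mul_exp_mul_sqrt_div] at hs
      have hmgf (i : ι) (l : ℝ) (h0 : 0 ≤ l) :=
        mgf_le_of_two_le hθ2 (hWm i) (hint i) (hle i) (hWint i) (hW0 i) h0
      have hΛ : 0 < Real.sqrt (L / (S.card * 2)) := by positivity
      refine measure_sum_ge_le_of_mgf_le hWm hind S (b := 0) (v := 2) (r := 0) two_pos
        hΛ (by linarith) hS (fun i _ l h0 _ => (hmgf i l h0).1)
        (fun i _ l h0 _ => by simpa using (hmgf i l h0).2) le_rfl (Or.inl le_rfl) (le_trans ?_ hs)
      rw [Real.sqrt_mul (by norm_num)]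
      simp only [mul_zero, zero_add, zero_mul, add_zero]
      rw [← mul_assoc]
      gcongr
      norm_num

/-- Normalisation to size 1 yields the constant at C = 1; the C-dependent maximum in D is always at
least 1. -/
theorem constD_one_le {θ C : ℝ} (hC : 0 < C) : constD θ 1 ≤ constD θ C := by
  have h (a : ℝ) (ha : 0 ≤ a) : max (1 : ℝ)⁻¹ (1 ^ a) ≤ max C⁻¹ (C ^ a) := by
    rw [inv_one, Real.one_rpow, max_self]
    rcases le_total C 1 with h | h
    · exact le_max_of_le_left ((one_le_inv₀ hC).mpr h)
    · exact le_max_of_le_right (Real.one_le_rpow h ha)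
  unfold constD
  split_ifs with h1 h2
  · rfl
  · exact mul_le_mul_of_nonneg_left (h _ (by linarith)) (Real.sqrt_nonneg _)
  · exact mul_le_mul_of_nonneg_left (h _ (by linarith)) (Real.sqrt_nonneg _)

theorem constD_nonneg {θ C : ℝ} (hθ : 0 < θ) (hC : 0 < C) : 0 ≤ constD θ C := by
  unfold constD
  split_ifs <;> positivity

theorem constE_nonneg (θ : ℝ) : 0 ≤ constE θ := by
  unfold constE
  split_ifs <;> positivity

/-! ### Deviation of the mean over a fixed index set -/

theorem measure_radius_le_abs_mean_le {θ C μ : ℝ} (hθ : 0 < θ) (hC : 0 < C) {ι : Type*}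
    {X : ι → Ω → ℝ} (hXm : ∀ t, Measurable (X t)) (hXindep : iIndepFun X P)
    (hXmean : ∀ t, ∫ ω, X t ω ∂P = μ)
    (hXsubW : ∀ t, IsSubWeibull P (fun ω => X t ω - μ) θ C)
    {S : Finset ι} (hS : S.Nonempty) {p : ℝ} {n : ℕ} (hpn : 0 < p * n) (hnS : p * n ≤ 2 * S.card)
    {δ : ℝ} (hδ : 0 < δ) (hδ1 : δ ≤ 1) :
    P.real {ω | radius θ C p n δ ≤ |μ - 1 / (S.card : ℝ) * ∑ t ∈ S, X t ω|} ≤ 3 / 4 * δ := by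
  set L := Real.log (4 / δ) with hLdef
  have hexpL : Real.exp (-L) = δ / 4 := by
    rw [hLdef, Real.exp_neg, Real.exp_log (by positivity), inv_div]
  have hL1 : 1 ≤ L := by
    rw [hLdef, Real.le_log_iff_exp_le (by positivity)]
    have h4 : (4 : ℝ) ≤ 4 / δ := by rw [le_div_iff₀ hδ]; linarith
    linarith [Real.exp_one_lt_d9]
  have hm : (0 : ℝ) < S.card := by exact_mod_cast hS.card_pos
  have hWabs (t : ι) (ω : Ω) : |(X t ω - μ) / C| ^ θ = |X t ω - μ| ^ θ / C ^ θ := by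
    rw [abs_div, abs_of_pos hC, Real.div_rpow (abs_nonneg _) hC.le]
  have hWm (t : ι) : Measurable fun ω => (X t ω - μ) / C := ((hXm t).sub_const μ).div_const C
  have hint (t : ι) : Integrable (fun ω => Real.exp (|(X t ω - μ) / C| ^ θ)) P := by
    simpa only [hWabs] using (hXsubW t).integrable
  have hle (t : ι) : ∫ ω, Real.exp (|(X t ω - μ) / C| ^ θ) ∂P ≤ 2 := by
    simpa only [hWabs] using (hXsubW t).integral_le
  have hB := constB_pos hθ
  -- The integral of a nonintegrable function is 0 by convention, so a prescribed mean does not give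
  -- integrability; the exponential moment does.
  have hWint (t : ι) : Integrable (fun ω => (X t ω - μ) / C) P := by
    refine integrable_of_le_exp (hWm t) (hint t) measurable_id (constB θ) fun x => ?_
    refine (le_constB_mul_exp_half hθ (abs_nonneg x)).trans ?_
    gcongr
    linarith [Real.rpow_nonneg (abs_nonneg x) θ]
  have hXint (t : ι) : Integrable (X t) P := by
    convert! ((hWint t).const_mul C).add (integrable_const μ) using 1
    ext ω
    simp only [Pi.add_apply]
    field_simp
    ring
  have hW0 (t : ι) : ∫ ω, (X t ω - μ) / C ∂P = 0 := by
    rw [integral_div, integral_sub (hXint t) (integrable_const μ), hXmean]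
    simp
  have hind : iIndepFun (fun t ω => (X t ω - μ) / C) P :=
    hXindep.comp (fun _ x => (x - μ) / C) fun _ => by fun_prop
  have hind' : iIndepFun (fun t ω => -((X t ω - μ) / C)) P :=
    hXindep.comp (fun _ x => -((x - μ) / C)) fun _ => by fun_prop
  set s := 2 * Real.exp 1 * constD θ 1 *
      (Real.sqrt (L * S.card) + constE θ * L ^ max (1 / θ) 1) with hs
  have hup := measure_sum_ge_le hθ hWm hind hint hle hWint hW0 hS hL1
    (by rw [hexpL]; linarith) hs.ge
  have hlow := measure_sum_ge_le (W := fun t ω => -((X t ω - μ) / C)) hθ (fun t => (hWm t).neg) hind'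
    (fun t => by simpa only [abs_neg] using hint t)
    (fun t => by simpa only [abs_neg] using hle t) (fun t => (hWint t).neg)
    (fun t => by rw [integral_neg, hW0, neg_zero]) hS hL1
    (by rw [hexpL]; linarith) hs.ge
  have hrad : s ≤ S.card / C * radius θ C p n δ := by
    have h0 : 0 ≤ constE θ := constE_nonneg θ
    have hD := constD_nonneg hθ hC
    -- The hypothesis |S| ≥ pn/2 enters here: sqrt(L |S|) = |S| sqrt(L / |S|).
    have h1 : Real.sqrt (L * S.card) ≤ S.card * Real.sqrt (2 * L / (p * n)) := by
      rw [Real.sqrt_le_left (by positivity), mul_pow, Real.sq_sqrt (by positivity),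
        ← mul_div_assoc, le_div_iff₀ hpn]
      have : 0 ≤ L * S.card := by positivity
      nlinarith
    have h2 : L ^ max (1 / θ) 1 ≤ S.card * (2 * L ^ max (1 / θ) 1 / (p * n)) := by
      rw [← mul_div_assoc, le_div_iff₀ hpn]
      have : 0 ≤ L ^ max (1 / θ) 1 := by positivity
      nlinarith
    calc s ≤ 2 * Real.exp 1 * constD θ C * (S.card * Real.sqrt (2 * L / (p * n)) +
          constE θ * (S.card * (2 * L ^ max (1 / θ) 1 / (p * n)))) := by
          rw [hs]
          have := constD_one_le (θ := θ) hC
          gcongr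
      _ = _ := by rw [radius, ← hLdef]; field_simp
  have hsub : {ω | radius θ C p n δ ≤ |μ - 1 / (S.card : ℝ) * ∑ t ∈ S, X t ω|} ⊆
      {ω | s ≤ ∑ t ∈ S, (X t ω - μ) / C} ∪ {ω | s ≤ ∑ t ∈ S, -((X t ω - μ) / C)} := by
    intro ω hω
    simp only [Set.mem_ofPred_eq, Set.mem_union] at hω ⊢
    have h1 : ∑ t ∈ S, (X t ω - μ) / C =
        -(S.card / C * (μ - 1 / (S.card : ℝ) * ∑ t ∈ S, X t ω)) := by
      rw [← Finset.sum_div, Finset.sum_sub_distrib, Finset.sum_const, nsmul_eq_mul]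
      field_simp
      ring
    rw [Finset.sum_neg_distrib, h1, neg_neg, or_comm, ← le_abs,
      abs_mul, abs_of_pos (by positivity)]
    exact hrad.trans (by gcongr)
  calc _ ≤ _ := measureReal_mono hsub
    _ ≤ _ := measureReal_union_le _ _
    _ ≤ _ := by rw [hexpL] at hup hlow; linarith

/-! ### The random set of observed indices -/

omit [IsProbabilityMeasure P] in
theorem ae_eq_one_or_zero_of_hasLaw_bernoulli {p : unitInterval} {Y : Ω → ℝ}
    (hY : HasLaw Y (bernoulliMeasure (1 : ℝ) 0 p) P) : ∀ᵐ ω ∂P, Y ω = 1 ∨ Y ω = 0 := by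
  have hs : MeasurableSet {x : ℝ | x = 1 ∨ x = 0} :=
    (measurableSet_singleton 1).union (measurableSet_singleton 0)
  refine (hY.ae_iff (p := fun x => x = 1 ∨ x = 0) (measurableSet_setOfPred.mp hs)).mpr ?_
  rw [ae_iff]
  exact bernoulliMeasure_apply_of_notMem_of_notMem p hs.compl (by simp) (by simp)

theorem measure_sum_bernoulli_le {p : unitInterval} {n : ℕ} {Y : Fin n → Ω → ℝ}
    (hYm : ∀ t, Measurable (Y t)) (hYindep : iIndepFun Y P)
    (hYlaw : ∀ t, HasLaw (Y t) (bernoulliMeasure (1 : ℝ) 0 p) P) :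
    P.real {ω | ∑ t, Y t ω ≤ p * n / 2} ≤ Real.exp (-(n * (p : ℝ) ^ 2 / 2)) := by
  have hmean (t : Fin n) : ∫ ω, Y t ω ∂P = p := by
    rw [(hYlaw t).integral_eq, integral_bernoulliMeasure]; simp
  have hsub (t : Fin n) :
      HasSubgaussianMGF (fun ω => -Y t ω - ∫ ω, -Y t ω ∂P) ((‖(0 : ℝ) - -1‖₊ / 2) ^ 2) P := by
    refine hasSubgaussianMGF_of_mem_Icc (hYm t).neg.aemeasurable ?_
    filter_upwards [ae_eq_one_or_zero_of_hasLaw_bernoulli (hYlaw t)] with ω hω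
    rcases hω with h | h <;> simp [h]
  have hind : iIndepFun (fun t ω => -Y t ω - ∫ ω, -Y t ω ∂P) P :=
    hYindep.comp (fun t x => -x - ∫ ω, -Y t ω ∂P) fun _ => by fun_prop
  have hp0 : (0 : ℝ) ≤ p := p.2.1
  -- Each summand has variance proxy 1/4, so a deviation of pn/2 gives the exponent -(pn/2)² / (n/2)
  -- = -n p² / 2.
  have h := HasSubgaussianMGF.measure_sum_ge_le_of_iIndepFun hind (s := Finset.univ) (fun t _ => hsub t)
    (ε := p * n / 2) (by positivity)
  refine (measureReal_mono fun ω hω => ?_).trans (h.trans_eq ?_)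
  · simp only [Set.mem_ofPred_eq, integral_neg, hmean] at hω ⊢
    simp only [sub_neg_eq_add, Finset.sum_add_distrib, Finset.sum_neg_distrib, Finset.sum_const,
      Finset.card_univ, Fintype.card_fin, nsmul_eq_mul]
    linarith
  · congr 1
    rcases Nat.eq_zero_or_pos n with rfl | hn
    · simp
    · have : (0 : ℝ) < n := by exact_mod_cast hn
      simp
      field_simp

/-- The set of outcomes at which exactly the indices in `S` are observed. -/
def observedOn {n : ℕ} (Y : Fin n → Ω → ℝ) (S : Finset (Fin n)) : Set Ω :=
  {ω | ∀ t, t ∈ S ↔ Y t ω = 1}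

omit [MeasurableSpace Ω] in
theorem reward_eq_ite {n : ℕ} {X Y : Fin n → Ω → ℝ} {S : Finset (Fin n)} {ω : Ω}
    (hS : ω ∈ observedOn Y S) (hY : ∀ t, Y t ω = 1 ∨ Y t ω = 0) (t : Fin n) :
    reward (X t ω) (Y t ω) = if t ∈ S then X t ω else 0 := by
  split_ifs with h
  · simp [reward, (hS t).mp h]
  · simp [reward, (hY t).resolve_left fun h1 => h ((hS t).mpr h1)]

omit [MeasurableSpace Ω] in
theorem numObserved_eq_card {n : ℕ} {X Y : Fin n → Ω → ℝ} {S : Finset (Fin n)} {ω : Ω}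
    (hS : ω ∈ observedOn Y S) (hY : ∀ t, Y t ω = 1 ∨ Y t ω = 0) (hX : ∀ t, X t ω ≠ 0) :
    numObserved (fun t => reward (X t ω) (Y t ω)) = S.card := by
  rw [numObserved, ← Set.ncard_coe_finset]
  congr 1
  ext t
  simp [reward_eq_ite hS hY, hX]

omit [MeasurableSpace Ω] in
theorem observedMean_eq {n : ℕ} {X Y : Fin n → Ω → ℝ} {S : Finset (Fin n)} {ω : Ω}
    (hS : ω ∈ observedOn Y S) (hY : ∀ t, Y t ω = 1 ∨ Y t ω = 0) (hX : ∀ t, X t ω ≠ 0) :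
    observedMean (fun t => reward (X t ω) (Y t ω)) = 1 / (S.card : ℝ) * ∑ t ∈ S, X t ω := by
  rw [observedMean, numObserved_eq_card hS hY hX]
  simp [reward_eq_ite hS hY]

omit [MeasurableSpace Ω] in
theorem sum_eq_card {n : ℕ} {Y : Fin n → Ω → ℝ} {S : Finset (Fin n)} {ω : Ω}
    (hS : ω ∈ observedOn Y S) (hY : ∀ t, Y t ω = 1 ∨ Y t ω = 0) : ∑ t, Y t ω = S.card := by
  have h (t : Fin n) : Y t ω = if t ∈ S then 1 else 0 := by
    split_ifs with h
    · exact (hS t).mp h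
    · exact (hY t).resolve_left fun h1 => h ((hS t).mpr h1)
  simp [h]

theorem measurableSet_observed {n : ℕ} (S : Finset (Fin n)) :
    MeasurableSet {y : Fin n → ℝ | ∀ t, t ∈ S ↔ y t = 1} := by
  simp only [Set.ofPred_forall]
  refine MeasurableSet.iInter fun t => ?_
  have h : MeasurableSet {y : Fin n → ℝ | y t = 1} :=
    measurable_pi_apply t (measurableSet_singleton 1)
  by_cases hS : t ∈ S
  · simpa only [hS, true_iff] using h
  · simp only [hS, false_iff]
    exact h.compl

/-- Total probability over the observed set: each intersection factorises by independence, and the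
events `observedOn Y S` are disjoint, so their probabilities sum to at most 1. No factor for the
number of sets is lost. -/
theorem measure_biUnion_observedOn_inter_le {n : ℕ} {X Y : Fin n → Ω → ℝ}
    (hYm : ∀ t, Measurable (Y t))
    (hXY : IndepFun (fun ω t => X t ω) (fun ω t => Y t ω) P) (F : Finset (Finset (Fin n)))
    {B : Finset (Fin n) → Set (Fin n → ℝ)} (hB : ∀ S, MeasurableSet (B S)) {q : ℝ} (hq : 0 ≤ q)
    (hBq : ∀ S ∈ F, P.real {ω | (fun t => X t ω) ∈ B S} ≤ q) :
    P.real (⋃ S ∈ F, {ω | (fun t => X t ω) ∈ B S} ∩ observedOn Y S) ≤ q := by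
  have hAm (S : Finset (Fin n)) : MeasurableSet (observedOn Y S) :=
    (measurable_pi_lambda (fun ω t => Y t ω) hYm) (measurableSet_observed S)
  have hdisj : (F : Set (Finset (Fin n))).PairwiseDisjoint (observedOn Y) := by
    intro S _ S' _ hne
    refine Set.disjoint_left.mpr fun ω h h' => hne ?_
    ext t
    rw [h t, h' t]
  calc P.real (⋃ S ∈ F, {ω | (fun t => X t ω) ∈ B S} ∩ observedOn Y S)
      ≤ ∑ S ∈ F, P.real ({ω | (fun t => X t ω) ∈ B S} ∩ observedOn Y S) :=
        measureReal_biUnion_finset_le _ _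
    _ = ∑ S ∈ F, P.real {ω | (fun t => X t ω) ∈ B S} * P.real (observedOn Y S) := by
        refine Finset.sum_congr rfl fun S _ => ?_
        have h := hXY.measure_inter_preimage_eq_mul (B S) _ (hB S) (measurableSet_observed S)
        rw [measureReal_def, measureReal_def, measureReal_def, ← ENNReal.toReal_mul]
        exact congrArg ENNReal.toReal h
    _ ≤ ∑ S ∈ F, q * P.real (observedOn Y S) := by
        gcongr with S hS
        exact hBq S hS
    _ = q * P.real (⋃ S ∈ F, observedOn Y S) := by
        rw [← Finset.mul_sum, measureReal_biUnion_finset hdisj fun S _ => hAm S]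
    _ ≤ q * 1 := by gcongr; exact measureReal_le_one
    _ = q := mul_one q

end ZeroInflated

theorem mainTheorem6 {Ω : Type*} [MeasurableSpace Ω] (P : Measure Ω) [IsProbabilityMeasure P]
    (θ C μ : ℝ) (hθ : 0 < θ) (hC : 0 < C) (p : unitInterval) (hp : 0 < p)
    (n : ℕ) (X Y : Fin n → Ω → ℝ)
    -- `X_1, …, X_n` are i.i.d. with mean `μ`, without an atom at `0`, and `X_t - μ ∼ subW(θ; C)`
    (hXm : ∀ t, Measurable (X t)) (hXindep : iIndepFun X P)
    (hXident : ∀ s t, IdentDistrib (X s) (X t) P P)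
    (hXmean : ∀ t, ∫ ω, X t ω ∂P = μ)
    (hXzero : ∀ t, P {ω | X t ω = 0} = 0)
    (hXsubW : ∀ t, ZeroInflated.IsSubWeibull P (fun ω => X t ω - μ) θ C)
    -- `Y_1, …, Y_n` are i.i.d. Bernoulli(`p`)
    (hYm : ∀ t, Measurable (Y t)) (hYindep : iIndepFun Y P)
    (hYlaw : ∀ t, HasLaw (Y t) (bernoulliMeasure (1 : ℝ) 0 p) P)
    -- the two sequences are independent of each other
    (hXY : IndepFun (fun ω t => X t ω) (fun ω t => Y t ω) P)
    (δ : ℝ) (hδ : 0 < δ) (hn : 4 * Real.log (2 / δ) / (p : ℝ) ^ 2 ≤ (n : ℝ)) :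
    P.real {ω | ZeroInflated.numObserved (fun t => ZeroInflated.reward (X t ω) (Y t ω)) = 0 ∨
        ZeroInflated.radius θ C p n δ ≤
          |μ - ZeroInflated.observedMean (fun t => ZeroInflated.reward (X t ω) (Y t ω))|} ≤ δ := by
  rcases le_or_gt 1 δ with hδ1 | hδ1
  · exact measureReal_le_one.trans hδ1
  have hp0 : (0 : ℝ) < p := hp
  have hlog : 0 < Real.log (2 / δ) := Real.log_pos (by rw [lt_div_iff₀ hδ]; linarith)
  have hn0 : (0 : ℝ) < n := lt_of_lt_of_le (by positivity) hn
  have hpn : (0 : ℝ) < p * n := by positivity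
  classical
  let F : Finset (Finset (Fin n)) := {S | (p : ℝ) * n / 2 < S.card}
  let B : Finset (Fin n) → Set (Fin n → ℝ) := fun S =>
    {x | ZeroInflated.radius θ C p n δ ≤ |μ - 1 / (S.card : ℝ) * ∑ t ∈ S, x t|}
  have hB (S : Finset (Fin n)) : MeasurableSet (B S) :=
    measurableSet_le measurable_const (by fun_prop)
  have hcard (S : Finset (Fin n)) (hS : S ∈ F) : (p : ℝ) * n / 2 < S.card := by
    simpa [F] using hS
  have hmean := ZeroInflated.measure_biUnion_observedOn_inter_le hYm hXY F hB
    (q := 3 / 4 * δ) (by positivity) fun S hS => by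
      have hS2 := hcard S hS
      have hne : S.Nonempty := by
        rw [← Finset.card_pos, ← Nat.cast_pos (α := ℝ)]
        linarith
      exact ZeroInflated.measure_radius_le_abs_mean_le hθ hC hXm hXindep hXmean hXsubW hne hpn
        (by linarith) hδ hδ1.le
  have hcount : P.real {ω | ∑ t, Y t ω ≤ p * n / 2} ≤ 1 / 4 * δ := by
    refine (ZeroInflated.measure_sum_bernoulli_le hYm hYindep hYlaw).trans ?_
    -- The sample-size condition makes the exponent at least 2 log(2/δ), giving δ²/4, which is at
    -- most δ/4 since δ < 1.
    rw [div_le_iff₀ (by positivity)] at hn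
    calc Real.exp (-(n * (p : ℝ) ^ 2 / 2)) ≤ Real.exp (-Real.log (2 / δ) + -Real.log (2 / δ)) :=
          Real.exp_le_exp.mpr (by linarith)
      _ = δ / 2 * (δ / 2) := by
          rw [Real.exp_add, Real.exp_neg, Real.exp_log (by positivity), inv_div]
      _ ≤ 1 / 4 * δ := by nlinarith
  have hX0 : ∀ᵐ ω ∂P, ∀ t, X t ω ≠ 0 := ae_all_iff.mpr fun t => by
    rw [ae_iff]; simpa using hXzero t
  have hY01 : ∀ᵐ ω ∂P, ∀ t, Y t ω = 1 ∨ Y t ω = 0 := ae_all_iff.mpr fun t =>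
    ZeroInflated.ae_eq_one_or_zero_of_hasLaw_bernoulli (hYlaw t)
  have hsub : {ω | ZeroInflated.numObserved
        (fun t => ZeroInflated.reward (X t ω) (Y t ω)) = 0 ∨ ZeroInflated.radius θ C p n δ ≤
          |μ - ZeroInflated.observedMean (fun t => ZeroInflated.reward (X t ω) (Y t ω))|} ≤ᵐ[P]
      ({ω | ∑ t, Y t ω ≤ p * n / 2} ∪
        ⋃ S ∈ F, {ω | (fun t => X t ω) ∈ B S} ∩ ZeroInflated.observedOn Y S : Set Ω) := by
    filter_upwards [hX0, hY01] with ω hX hY hω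
    change ω ∈ ({ω | ∑ t, Y t ω ≤ p * n / 2} ∪
      ⋃ S ∈ F, {ω | (fun t => X t ω) ∈ B S} ∩ ZeroInflated.observedOn Y S : Set Ω)
    have hS : ω ∈ ZeroInflated.observedOn Y {t | Y t ω = 1} := fun t => by simp
    set S : Finset (Fin n) := {t | Y t ω = 1}
    have hsum := ZeroInflated.sum_eq_card hS hY
    rcases le_or_gt (∑ t, Y t ω) (p * n / 2) with h | h
    · exact Or.inl h
    · right
      rw [hsum] at h
      have hω' : ZeroInflated.numObserved (fun t => ZeroInflated.reward (X t ω) (Y t ω)) = 0 ∨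
        ZeroInflated.radius θ C p n δ ≤
          |μ - ZeroInflated.observedMean (fun t => ZeroInflated.reward (X t ω) (Y t ω))| := hω
      rw [ZeroInflated.numObserved_eq_card hS hY hX, ZeroInflated.observedMean_eq hS hY hX] at hω'
      -- Having no observation is excluded here, since |S| > pn/2 > 0; that event lies inside the
      -- small-count event.
      rcases hω' with h0 | h1
      · rw [h0, Nat.cast_zero] at h
        linarith
      · exact Set.mem_biUnion (Finset.mem_coe.mpr (by simpa [F] using h)) ⟨h1, hS⟩
  calc _ ≤ _ := ENNReal.toReal_mono (measure_ne_top P _) (measure_mono_ae hsub)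
    _ ≤ _ := measureReal_union_le _ _
    _ ≤ δ := by linarith
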